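/- Let $n\ge 1$. Let $H_n$ be the Heisenberg group of dimension $2n+1$, with Lie algebra $\mathfrak h_n$ spanned by $X_1,\dots,X_{2n},Z$, where $[X_i,X_{n+i}]=Z$ for $1\le i\le n$ and all other brackets of basis vectors vanish. Let $\mathfrak v_0=\mathrm{span}(X_1,\dots,X_{2n})$. For an $n$-tuple $r=(r_1,\dots,r_n)$ of positive integers with $r_i\mid r_{i+1}$, let $$\Gamma_r=\langle \exp(r_1X_1),\dots,\exp(r_nX_n),\exp(X_{n+1}),\dots,\exp(X_{2n}),\exp(Z)\rangle\subset H_n .$$ For $A\in GL_{2n}(\mathbb R)$, acting on $\mathfrak v_0$ in the basis $X_1,\dots,X_{2n}$, let $\langle\cdot,\cdot\rangle_A$ be the inner product on $\mathfrak v_0$ with orthonormal basis $AX_1,\dots,AX_{2n}$. Let $dist_A$ be the distance on $\Gamma_r\backslash H_n$ induced by the left invariant sub-Riemannian structure $(\mathfrak v_0,\langle\cdot,\cdot\rangle_A)$ of corank $1$ on $H_n$, and let $v(\mathfrak v_0,A)$ be its Popp volume: $v(\mathfrak v_0,A)=\nu^1\wedge\dots\wedge\nu^{2n+1}$ for the coframe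 dual to the left invariant frame $AX_1,\dots,AX_{2n},Z/\|Z\|$. Here $\|Z\|$ is the norm of $Z$ in $\mathfrak h_n/\mathfrak v_0$ for the quotient norm under $\mathfrak v_0\otimes\mathfrak v_0\to\mathfrak h_n/\mathfrak v_0$, $u\otimes v\mapsto[u,v]$. Let $sys(\Gamma_r\backslash H_n,dist_A)$ be the infimum of the $dist_A$-lengths of the closed curves in $\Gamma_r\backslash H_n$ that are not contractible. **Theorem.** For every $n\ge1$ there is a constant $C_n>0$, depending only on $n$, such that for all $r$ and $A$ as above the total Popp volume of $\Gamma_r\backslash H_n$ is finite and $$sys(\Gamma_r\backslash H_n,dist_A)\le C_n\left|\int_{\Gamma_r\backslash H_n}v(\mathfrak v_0,A)\right|^{\frac1{2n+2}} .$$ -/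

import Mathlib

open MeasureTheory Set
open scoped ENNReal unitInterval MatrixGroups

/-- The `n`-th Heisenberg Lie algebra as a vector space, in the coordinates of the basis
`X_1, …, X_n, X_{n+1}, …, X_{2n}, Z`; `Sum.inl i` is the index of `X_i` and `Sum.inr i` that of
`X_{n+i}`. -/
abbrev HeisenbergAlgebra (n : ℕ) : Type := (Fin n ⊕ Fin n → ℝ) × ℝ

namespace HeisenbergAlgebra

variable {n : ℕ}

/-- The basis vector `X_i`. -/
def X (i : Fin n ⊕ Fin n) : HeisenbergAlgebra n := (Pi.single i 1, 0)

/-- The basis vector `Z`. -/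
def Z : HeisenbergAlgebra n := (0, 1)

/-- The Lie bracket: `[X_i, X_{n+i}] = Z = -[X_{n+i}, X_i]`, the other brackets of basis vectors
are zero. -/
noncomputable def bracket (u v : HeisenbergAlgebra n) : HeisenbergAlgebra n :=
  (0, ∑ i : Fin n, (u.1 (Sum.inl i) * v.1 (Sum.inr i) - u.1 (Sum.inr i) * v.1 (Sum.inl i)))

/-- The subspace `𝔳₀` spanned by `X_1, …, X_{2n}`. -/
def horizontal (n : ℕ) : Submodule ℝ (HeisenbergAlgebra n) :=
  LinearMap.ker (LinearMap.snd ℝ (Fin n ⊕ Fin n → ℝ) ℝ)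

@[simp] lemma bracket_fst (u v : HeisenbergAlgebra n) : (bracket u v).1 = 0 := rfl

lemma bracket_add_left (u v w : HeisenbergAlgebra n) :
    bracket (u + v) w = bracket u w + bracket v w := by
  refine Prod.ext (by simp) ?_
  simp only [bracket, Prod.fst_add, Prod.snd_add, Pi.add_apply, ← Finset.sum_add_distrib]
  exact Finset.sum_congr rfl fun i _ => by ring

lemma bracket_add_right (u v w : HeisenbergAlgebra n) :
    bracket u (v + w) = bracket u v + bracket u w := by
  refine Prod.ext (by simp) ?_
  simp only [bracket, Prod.fst_add, Prod.snd_add, Pi.add_apply, ← Finset.sum_add_distrib]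
  exact Finset.sum_congr rfl fun i _ => by ring

lemma bracket_smul_right (c : ℝ) (u v : HeisenbergAlgebra n) :
    bracket u (c • v) = c • bracket u v := by
  refine Prod.ext (by simp) ?_
  simp only [bracket, Prod.smul_fst, Prod.smul_snd, Pi.smul_apply, smul_eq_mul, Finset.mul_sum]
  exact Finset.sum_congr rfl fun i _ => by ring

@[simp] lemma bracket_self (u : HeisenbergAlgebra n) : bracket u u = 0 := by
  refine Prod.ext (by simp) ?_
  simp [bracket, mul_comm]

lemma bracket_bracket_left (u v w : HeisenbergAlgebra n) : bracket (bracket u v) w = 0 := by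
  refine Prod.ext (by simp) ?_
  simp [bracket]

lemma bracket_bracket_right (u v w : HeisenbergAlgebra n) : bracket u (bracket v w) = 0 := by
  refine Prod.ext (by simp) ?_
  simp [bracket]

@[simp] lemma bracket_zero_left (u : HeisenbergAlgebra n) : bracket 0 u = 0 :=
  Prod.ext (by simp) (by simp [bracket])

@[simp] lemma bracket_zero_right (u : HeisenbergAlgebra n) : bracket u 0 = 0 :=
  Prod.ext (by simp) (by simp [bracket])

lemma bracket_neg_left (u v : HeisenbergAlgebra n) : bracket (-u) v = -bracket u v := by
  have h := bracket_add_left u (-u) v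
  rw [add_neg_cancel, bracket_zero_left] at h
  exact (neg_eq_of_add_eq_zero_right h.symm).symm

end HeisenbergAlgebra

/-- The `n`-th Heisenberg group, the simply connected Lie group of the Heisenberg Lie algebra, in
exponential coordinates: every element is `exp v` for a unique `v` in the Lie algebra. -/
@[ext]
structure HeisenbergGroup (n : ℕ) where
  /-- The exponential map. -/
  exp ::
  /-- The logarithm, inverse to the exponential map. -/
  log : HeisenbergAlgebra n

namespace HeisenbergGroup

open HeisenbergAlgebra

variable {n : ℕ}

/-- `exp u * exp v = exp (u + v + [u, v] / 2)`, the Baker-Campbell-Hausdorff formula. -/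
noncomputable instance : Mul (HeisenbergGroup n) :=
  ⟨fun x y => exp (x.log + y.log + (1 / 2 : ℝ) • bracket x.log y.log)⟩

noncomputable instance : One (HeisenbergGroup n) := ⟨exp 0⟩

noncomputable instance : Inv (HeisenbergGroup n) := ⟨fun x => exp (-x.log)⟩

lemma log_mul (x y : HeisenbergGroup n) :
    (x * y).log = x.log + y.log + (1 / 2 : ℝ) • bracket x.log y.log := rfl

lemma log_one : (1 : HeisenbergGroup n).log = 0 := rfl

lemma log_inv (x : HeisenbergGroup n) : x⁻¹.log = -x.log := rfl

lemma bracket_half_left (u v w : HeisenbergAlgebra n) :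
    bracket ((1 / 2 : ℝ) • bracket u v) w = 0 :=
  Prod.ext (by simp) (by simp [bracket])

noncomputable instance : Group (HeisenbergGroup n) :=
  Group.ofLeftAxioms
    (fun x y z => by
      ext1
      simp only [log_mul, bracket_add_left, bracket_add_right, bracket_smul_right,
        bracket_half_left, bracket_bracket_right, smul_add, smul_zero, add_zero]
      abel)
    (fun x => by ext1; simp [log_mul, log_one])
    (fun x => by ext1; simp [log_mul, log_inv, log_one, bracket_neg_left])

/-- The topology of the Lie group: the exponential map is a homeomorphism. -/
instance : TopologicalSpace (HeisenbergGroup n) := TopologicalSpace.induced log inferInstance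

/-- The corresponding Borel measurable structure. -/
instance : MeasurableSpace (HeisenbergGroup n) := MeasurableSpace.comap log inferInstance

lemma measurable_exp : Measurable (exp : HeisenbergAlgebra n → HeisenbergGroup n) := by
  rintro s ⟨t, ht, rfl⟩
  exact ht

/-- The differential at the identity of the left translation by `x`, in exponential
coordinates. -/
noncomputable def leftDiff (x : HeisenbergGroup n) (w : HeisenbergAlgebra n) :
    HeisenbergAlgebra n :=
  w + (1 / 2 : ℝ) • bracket x.log w

/-- The inverse of `leftDiff x`. -/
noncomputable def leftDiffInv (x : HeisenbergGroup n) (w : HeisenbergAlgebra n) :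
    HeisenbergAlgebra n :=
  w - (1 / 2 : ℝ) • bracket x.log w

lemma hasFDerivAt_leftMul (x : HeisenbergGroup n) :
    ∃ L : HeisenbergAlgebra n →L[ℝ] HeisenbergAlgebra n, (∀ w, L w = leftDiff x w) ∧
      HasFDerivAt (fun v : HeisenbergAlgebra n => (x * exp v).log) L 0 := by
  let L₀ : HeisenbergAlgebra n →ₗ[ℝ] HeisenbergAlgebra n :=
    { toFun := leftDiff x
      map_add' := fun u v => by
        simp only [leftDiff, bracket_add_right, smul_add]; abel
      map_smul' := fun c u => by
        simp only [leftDiff, bracket_smul_right, smul_add, RingHom.id_apply, smul_comm c] }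
  refine ⟨L₀.toContinuousLinearMap, fun w => rfl, ?_⟩
  have h : (fun v : HeisenbergAlgebra n => (x * exp v).log)
      = fun v => x.log + L₀.toContinuousLinearMap v := by
    funext v
    change _ = x.log + (v + (1 / 2 : ℝ) • bracket x.log v)
    rw [log_mul]; abel
  rw [h]
  exact (L₀.toContinuousLinearMap.hasFDerivAt).const_add _

lemma leftDiff_leftDiffInv (x : HeisenbergGroup n) (w : HeisenbergAlgebra n) :
    leftDiff x (leftDiffInv x w) = w := by
  refine Prod.ext (by simp [leftDiff, leftDiffInv]) ?_
  simp [leftDiff, leftDiffInv, bracket]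

lemma leftDiffInv_leftDiff (x : HeisenbergGroup n) (w : HeisenbergAlgebra n) :
    leftDiffInv x (leftDiff x w) = w := by
  refine Prod.ext (by simp [leftDiff, leftDiffInv]) ?_
  simp [leftDiff, leftDiffInv, bracket]

/-- The index set `D_n`: `n`-tuples `r` of positive integers such that `r_i` divides `r_{i+1}`. -/
def latticeTypes (n : ℕ) : Set (Fin n → ℕ) :=
  {r | (∀ i, 0 < r i) ∧ ∀ i j : Fin n, (j : ℕ) = i + 1 → r i ∣ r j}

/-- The lattice `Γ_r`, generated by `exp (r_i X_i)`, `exp X_{n+i}` (`1 ≤ i ≤ n`) and `exp Z`. -/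
noncomputable def lattice (r : Fin n → ℕ) : Subgroup (HeisenbergGroup n) :=
  Subgroup.closure
    (range (fun i : Fin n => exp ((r i : ℝ) • X (Sum.inl i))) ∪
      range (fun i : Fin n => exp (X (Sum.inr i))) ∪ {exp Z})

/-- The compact Heisenberg manifold `Γ \ H_n`, the space of orbits of `Γ` acting on `H_n` by left
multiplication, with the quotient topology. -/
abbrev Manifold (Γ : Subgroup (HeisenbergGroup n)) : Type :=
  MulAction.orbitRel.Quotient Γ (HeisenbergGroup n)

/-! ### Left invariant sub-Riemannian metrics of corank one -/

/-- The vector `A X_i`, where `A` acts on `𝔳₀` in the basis `X_1, …, X_{2n}`. -/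
noncomputable def frame (A : GL (Fin n ⊕ Fin n) ℝ) (i : Fin n ⊕ Fin n) : HeisenbergAlgebra n :=
  ((A : Matrix (Fin n ⊕ Fin n) (Fin n ⊕ Fin n) ℝ).mulVec (X i).1, 0)

/-- The inner product `⟨·, ·⟩_A` on `𝔳₀`, for which `A X_1, …, A X_{2n}` is an orthonormal basis
(of a vector in the Lie algebra, only the component in `𝔳₀` is used). -/
noncomputable def metric (A : GL (Fin n ⊕ Fin n) ℝ) (u v : HeisenbergAlgebra n) : ℝ :=
  dotProduct
    (((A⁻¹ : GL (Fin n ⊕ Fin n) ℝ) : Matrix (Fin n ⊕ Fin n) (Fin n ⊕ Fin n) ℝ).mulVec u.1)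
    (((A⁻¹ : GL (Fin n ⊕ Fin n) ℝ) : Matrix (Fin n ⊕ Fin n) (Fin n ⊕ Fin n) ℝ).mulVec v.1)

lemma metric_frame (A : GL (Fin n ⊕ Fin n) ℝ) (i j : Fin n ⊕ Fin n) :
    metric A (frame A i) (frame A j) = if i = j then 1 else 0 := by
  have h : ((A⁻¹ : GL (Fin n ⊕ Fin n) ℝ) : Matrix (Fin n ⊕ Fin n) (Fin n ⊕ Fin n) ℝ) *
      (A : Matrix (Fin n ⊕ Fin n) (Fin n ⊕ Fin n) ℝ) = 1 := by
    rw [← Units.val_mul, inv_mul_cancel, Units.val_one]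
  simp only [metric, frame, X, Matrix.mulVec_mulVec, h, Matrix.one_mulVec, dotProduct_single,
    mul_one, Pi.single_apply, eq_comm]

/-- A path `c : [0, 1] → H_n` is admissible if it is absolutely continuous and, for almost every
`t`, its derivative lies in `𝓓_{c t}`, the left translate of `𝔳₀` to `c t`. -/
def IsAdmissible (c : ℝ → HeisenbergGroup n) : Prop :=
  AbsolutelyContinuousOnInterval (fun t => (c t).log) 0 1 ∧
    ∀ᵐ t ∂(volume.restrict (Icc (0 : ℝ) 1)), ∃ u ∈ horizontal n,
      HasDerivAt (fun s => (c s).log) (leftDiff (c t) u) t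

/-- The sub-Riemannian length of an admissible path: the integral over `[0, 1]` of the norm of the
left translate of the derivative to the identity. -/
noncomputable def pathLength (A : GL (Fin n ⊕ Fin n) ℝ) (c : ℝ → HeisenbergGroup n) : ℝ≥0∞ :=
  ∫⁻ t in Icc (0 : ℝ) 1, ENNReal.ofReal (Real.sqrt
    (metric A (leftDiffInv (c t) (deriv (fun s => (c s).log) t))
      (leftDiffInv (c t) (deriv (fun s => (c s).log) t))))

/-- The sub-Riemannian distance on `H_n`. -/
noncomputable def subRiemannianDist (A : GL (Fin n ⊕ Fin n) ℝ) (x y : HeisenbergGroup n) : ℝ≥0∞ :=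
  ⨅ (c : ℝ → HeisenbergGroup n) (_ : IsAdmissible c) (_ : c 0 = x) (_ : c 1 = y), pathLength A c

/-- The quotient distance `dist_A` on `Γ \ H_n`. -/
noncomputable def quotientDist (Γ : Subgroup (HeisenbergGroup n)) (A : GL (Fin n ⊕ Fin n) ℝ)
    (p q : Manifold Γ) : ℝ≥0∞ :=
  ⨅ (x : HeisenbergGroup n) (y : HeisenbergGroup n)
    (_ : (Quotient.mk _ x : Manifold Γ) = p) (_ : (Quotient.mk _ y : Manifold Γ) = q),
    subRiemannianDist A x y

/-! ### Popp's volume -/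

/-- The norm on `𝔥_n / 𝔳₀` induced by the surjection
`𝔳₀ ⊗ 𝔳₀ → 𝔥_n / 𝔳₀`, `u ⊗ v ↦ [u, v] mod 𝔳₀`, and the inner product on `𝔳₀ ⊗ 𝔳₀` for which
the `A X_i ⊗ A X_j` are orthonormal: the norm of the class of `z` is the least norm of a tensor
`∑ t_{ij} A X_i ⊗ A X_j` over that class. -/
noncomputable def poppNorm (A : GL (Fin n ⊕ Fin n) ℝ) (z : HeisenbergAlgebra n) : ℝ :=
  sInf {l : ℝ | ∃ t : Matrix (Fin n ⊕ Fin n) (Fin n ⊕ Fin n) ℝ,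
    (∑ i, ∑ j, t i j • bracket (frame A i) (frame A j)) - z ∈ horizontal n ∧
      l = Real.sqrt (∑ i, ∑ j, t i j ^ 2)}

/-- The coordinates with respect to the adapted frame `A X_1, …, A X_{2n}, Z / ‖Z‖` of `𝔥_n`, where
`‖Z‖` is the norm of the class of `Z` modulo `𝔳₀`. -/
noncomputable def adaptedCoframe (A : GL (Fin n ⊕ Fin n) ℝ) :
    HeisenbergAlgebra n →ₗ[ℝ] HeisenbergAlgebra n :=
  (Matrix.mulVecLin
    ((A⁻¹ : GL (Fin n ⊕ Fin n) ℝ) : Matrix (Fin n ⊕ Fin n) (Fin n ⊕ Fin n) ℝ)).prodMap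
    (poppNorm A Z • LinearMap.id)

/-- The measure on `H_n` of Popp's volume form, the wedge product of the adapted coframe. The
form `X_1^* ∧ ⋯ ∧ X_{2n}^* ∧ Z^*` is the Lebesgue measure in exponential coordinates. -/
noncomputable def poppMeasure (A : GL (Fin n ⊕ Fin n) ℝ) : Measure (HeisenbergGroup n) :=
  ENNReal.ofReal |LinearMap.det (adaptedCoframe A)| •
    Measure.map exp (volume : Measure (HeisenbergAlgebra n))

/-- The total measure of `Γ \ H_n` with respect to Popp's volume: the measure of a fundamental
domain of `Γ` in `H_n`. -/
noncomputable def totalPoppVolume (Γ : Subgroup (HeisenbergGroup n)) (A : GL (Fin n ⊕ Fin n) ℝ) :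
    ℝ≥0∞ :=
  covolume Γ (HeisenbergGroup n) (poppMeasure A)

end HeisenbergGroup

/-! ### The systole of a length space -/

/-- The length of a path with respect to a distance function `d`: the supremum over all partitions
of the sums of the distances of consecutive points. -/
noncomputable def metricLength {X : Type*} [TopologicalSpace X] (d : X → X → ℝ≥0∞) {x y : X}
    (c : Path x y) : ℝ≥0∞ :=
  ⨆ p : ℕ × {u : ℕ → I // Monotone u},
    ∑ i ∈ Finset.range p.1, d (c (p.2.1 i)) (c (p.2.1 (i + 1)))

/-- The systole: the infimum of the lengths of the loops that are not null-homotopic. -/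
noncomputable def systole {X : Type*} [TopologicalSpace X] (d : X → X → ℝ≥0∞) : ℝ≥0∞ :=
  ⨅ (x : X) (c : Path x x) (_ : ¬ c.Homotopic (Path.refl x)), metricLength d c

/-! The total Popp volume factors as `D * p`, where `D = |det A⁻¹| * ∏ r i` is the covolume, for the
metric given by `A`, of the projection of the lattice to `𝔳₀`, and `p = ‖Z‖`
(`totalPoppVolume_lattice`). Each factor bounds the systole separately.

Horizontal bound: Minkowski's theorem (`exists_short_vector`) gives a lattice element whose
horizontal component `v` is nonzero and of length at most a constant times `D ^ (1 / (2n))`. Its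
central component costs nothing: conjugation by `exp y` changes it by `[y, v]`, so from a suitable
base point the straight line in direction `v` closes up in the quotient (`systole_le_of_mem`).

Central bound: some bracket `ω` of two orthonormal frame vectors satisfies `1 / ω ≤ 2 * n * p`
(`exists_bracket_frame_pos`). The horizontal lift of a circle of area `1 / ω` in their plane joins
`1` to `exp Z`, and its length is at most a constant times `√p` (`systole_le_of_bracket_pos`).

Hence the power `2n` of the systole is bounded by a multiple of `D` and its square by a multiple of
`p`; multiplying gives the theorem. Both loops are non-contractible because their lifts to the
covering `H_n` are not closed (`IsHorizontalCurve.systole_le`). -/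

namespace HeisenbergGroup

open HeisenbergAlgebra

variable {n : ℕ}

/-! ### The topological group -/

lemma continuous_log : Continuous (log : HeisenbergGroup n → HeisenbergAlgebra n) :=
  continuous_induced_dom

lemma continuous_iff_log {X : Type*} [TopologicalSpace X] {f : X → HeisenbergGroup n} :
    Continuous f ↔ Continuous fun x => (f x).log :=
  continuous_induced_rng

lemma _root_.Continuous.heisenbergBracket {X : Type*} [TopologicalSpace X]
    {f g : X → HeisenbergAlgebra n} (hf : Continuous f) (hg : Continuous g) :
    Continuous fun x => bracket (f x) (g x) := by
  unfold bracket
  fun_prop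

instance : IsTopologicalGroup (HeisenbergGroup n) where
  continuous_mul := by
    have h₁ : Continuous fun p : HeisenbergGroup n × HeisenbergGroup n => p.1.log :=
      continuous_log.comp continuous_fst
    have h₂ : Continuous fun p : HeisenbergGroup n × HeisenbergGroup n => p.2.log :=
      continuous_log.comp continuous_snd
    have h₃ := h₁.heisenbergBracket h₂
    refine continuous_iff_log.2 ?_
    simp only [log_mul]
    fun_prop
  continuous_inv := continuous_iff_log.2 continuous_log.neg

/-! ### The elements of the lattice -/

/-- The lengths of the edges of the box spanned by the generators of `Γ_r` in `𝔳₀`. -/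
def edge (r : Fin n → ℕ) : Fin n ⊕ Fin n → ℕ := Sum.elim r 1

lemma edge_pos {r : Fin n → ℕ} (hr : r ∈ latticeTypes n) (i : Fin n ⊕ Fin n) : 0 < edge r i := by
  rcases i with i | i
  · exact hr.1 i
  · exact Nat.one_pos

lemma prod_edge (r : Fin n → ℕ) : ∏ i, edge r i = ∏ i, r i := by
  simp [edge]

/-- The general element of the lattice `Γ_r`. -/
noncomputable def latticePoint (r : Fin n → ℕ) (m : Fin n ⊕ Fin n → ℤ) (k : ℤ) :
    HeisenbergGroup n :=
  -- This is the product of `exp (∑ r_i m_i X_i)`, `exp (∑ m_{n+i} X_{n+i})` and `exp (k Z)`; the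
  -- half-sum is the Baker-Campbell-Hausdorff term of the first two factors.
  exp (fun i => edge r i * m i,
    k + (1 / 2 : ℝ) * ∑ i : Fin n, (r i * m (Sum.inl i) * m (Sum.inr i) : ℝ))

/-- Moving the second factor of the left element past the first factor of the right one costs a
commutator, which is an integral multiple of `Z`. In this parametrization the half-integers cancel
and `k` stays an integer. -/
lemma latticePoint_mul (r : Fin n → ℕ) (m m' : Fin n ⊕ Fin n → ℤ) (k k' : ℤ) :
    latticePoint r m k * latticePoint r m' k' = latticePoint r (m + m')
      (k + k' - ∑ i : Fin n, r i * m (Sum.inr i) * m' (Sum.inl i)) := by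
  ext1
  rw [log_mul]
  refine Prod.ext (funext fun i => ?_) ?_
  · simp [latticePoint, mul_add]
  · have h : (1 / 2 : ℝ) * ∑ i : Fin n, (r i * m (Sum.inl i) * m (Sum.inr i) : ℝ) +
        (1 / 2 : ℝ) * ∑ i : Fin n, (r i * m' (Sum.inl i) * m' (Sum.inr i) : ℝ) +
        (1 / 2 : ℝ) * ∑ i : Fin n, (r i * m (Sum.inl i) * (1 * m' (Sum.inr i)) -
          1 * m (Sum.inr i) * (r i * m' (Sum.inl i)) : ℝ) =
        (1 / 2 : ℝ) * ∑ i : Fin n, (r i * (m (Sum.inl i) + m' (Sum.inl i)) *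
          (m (Sum.inr i) + m' (Sum.inr i)) : ℝ) -
        ∑ i : Fin n, (r i * m (Sum.inr i) * m' (Sum.inl i) : ℝ) := by
      simp only [Finset.mul_sum, ← Finset.sum_add_distrib, ← Finset.sum_sub_distrib]
      exact Finset.sum_congr rfl fun i _ => by ring
    simp only [latticePoint, bracket, edge, Prod.snd_add, Prod.smul_snd, smul_eq_mul, Sum.elim_inl,
      Sum.elim_inr, Pi.one_apply, Pi.add_apply, Nat.cast_one]
    push_cast
    linear_combination h

lemma latticePoint_zero (r : Fin n → ℕ) : latticePoint r 0 0 = 1 := by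
  ext1
  refine Prod.ext (funext fun i => ?_) ?_ <;> simp [latticePoint, log_one]

lemma latticePoint_inv (r : Fin n → ℕ) (m : Fin n ⊕ Fin n → ℤ) (k : ℤ) :
    (latticePoint r m k)⁻¹ = latticePoint r (-m)
      (-k - ∑ i : Fin n, r i * m (Sum.inr i) * m (Sum.inl i)) := by
  rw [inv_eq_iff_mul_eq_one, latticePoint_mul, ← latticePoint_zero r]
  congr 1
  · simp
  · simp only [Pi.neg_apply, mul_neg, Finset.sum_neg_distrib]
    ring

/-- The subgroup of all `latticePoint r m k`. -/
noncomputable def latticePoints (r : Fin n → ℕ) : Subgroup (HeisenbergGroup n) where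
  carrier := {x | ∃ m k, x = latticePoint r m k}
  mul_mem' := by
    rintro _ _ ⟨m, k, rfl⟩ ⟨m', k', rfl⟩
    exact ⟨_, _, latticePoint_mul ..⟩
  one_mem' := ⟨0, 0, (latticePoint_zero r).symm⟩
  inv_mem' := by
    rintro _ ⟨m, k, rfl⟩
    exact ⟨_, _, latticePoint_inv ..⟩

lemma exp_add_of_bracket_eq_zero {u v : HeisenbergAlgebra n} (h : bracket u v = 0) :
    exp (u + v) = exp u * exp v := by
  ext1
  simp [log_mul, h]

/-- If `S` is an isotropic subspace then the elements of `S` with exponential in a subgroup of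
`H_n` form a subgroup. -/
def logSubgroup (Γ : Subgroup (HeisenbergGroup n)) (S : Submodule ℝ (HeisenbergAlgebra n))
    (hS : ∀ u ∈ S, ∀ v ∈ S, bracket u v = 0) : AddSubgroup (HeisenbergAlgebra n) where
  carrier := {u | u ∈ S ∧ exp u ∈ Γ}
  add_mem' := fun {u v} hu hv =>
    ⟨S.add_mem hu.1 hv.1, exp_add_of_bracket_eq_zero (hS u hu.1 v hv.1) ▸ Γ.mul_mem hu.2 hv.2⟩
  zero_mem' := ⟨S.zero_mem, Γ.one_mem⟩
  neg_mem' := fun hu => ⟨S.neg_mem hu.1, Γ.inv_mem hu.2⟩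

/-- The subspace of `𝔳₀` on which the coordinates with indices `e i` vanish: for `e = Sum.inr` it is
`span (X_1, …, X_n)`, for `e = Sum.inl` it is `span (X_{n+1}, …, X_{2n})`. -/
def coordinateSubspace (n : ℕ) (e : Fin n → Fin n ⊕ Fin n) :
    Submodule ℝ (HeisenbergAlgebra n) where
  carrier := {u | (∀ i, u.1 (e i) = 0) ∧ u.2 = 0}
  add_mem' := fun {u v} hu hv => ⟨fun i => by simp [hu.1 i, hv.1 i], by simp [hu.2, hv.2]⟩
  zero_mem' := by simp
  smul_mem' := fun c u hu => ⟨fun i => by simp [hu.1 i], by simp [hu.2]⟩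

lemma exp_smul_Z_mem_lattice (r : Fin n → ℕ) (k : ℤ) : exp ((k : ℝ) • Z) ∈ lattice r := by
  have h : ∀ u ∈ Submodule.span ℝ {(Z : HeisenbergAlgebra n)}, ∀ v ∈ Submodule.span ℝ {Z},
      bracket u v = 0 := by
    intro u hu v hv
    obtain ⟨a, rfl⟩ := Submodule.mem_span_singleton.1 hu
    obtain ⟨b, rfl⟩ := Submodule.mem_span_singleton.1 hv
    exact Prod.ext rfl (by simp [bracket, Z])
  have hZ : Z ∈ logSubgroup (lattice r) _ h :=
    ⟨Submodule.mem_span_singleton_self _, Subgroup.subset_closure (by simp)⟩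
  have := (logSubgroup (lattice r) _ h).zsmul_mem hZ k
  rw [← Int.cast_smul_eq_zsmul ℝ] at this
  exact this.2

/-- The generators fall into three commuting families, in `span (X_1, …, X_n)`, `span (X_{n+1}, …,
X_{2n})` and `span Z`. On each of these the exponential is additive, so integral combinations of
generators exponentiate into the lattice. -/
lemma latticePoint_mem_lattice (r : Fin n → ℕ) (m : Fin n ⊕ Fin n → ℤ) (k : ℤ) :
    latticePoint r m k ∈ lattice r := by
  have hl : ∀ u ∈ coordinateSubspace n Sum.inr, ∀ v ∈ coordinateSubspace n Sum.inr,
      bracket u v = 0 := fun u hu v hv => Prod.ext rfl (by simp [bracket, hu.1, hv.1])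
  have hr : ∀ u ∈ coordinateSubspace n Sum.inl, ∀ v ∈ coordinateSubspace n Sum.inl,
      bracket u v = 0 := fun u hu v hv => Prod.ext rfl (by simp [bracket, hu.1, hv.1])
  have h₁ : ∑ i : Fin n, m (Sum.inl i) • ((r i : ℝ) • (X (Sum.inl i) : HeisenbergAlgebra n)) ∈
      logSubgroup (lattice r) _ hl := by
    refine sum_mem fun i _ => (logSubgroup (lattice r) _ hl).zsmul_mem
      ⟨⟨fun j => ?_, ?_⟩, Subgroup.subset_closure ?_⟩ _
    · simp [X]
    · simp [X]
    · exact Or.inl (Or.inl ⟨i, rfl⟩)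
  have h₂ : ∑ i : Fin n, m (Sum.inr i) • (X (Sum.inr i) : HeisenbergAlgebra n) ∈
      logSubgroup (lattice r) _ hr := by
    refine sum_mem fun i _ => (logSubgroup (lattice r) _ hr).zsmul_mem
      ⟨⟨fun j => ?_, ?_⟩, Subgroup.subset_closure ?_⟩ _
    · simp [X]
    · simp [X]
    · exact Or.inl (Or.inr ⟨i, rfl⟩)
  have h := (lattice r).mul_mem ((lattice r).mul_mem h₁.2 h₂.2) (exp_smul_Z_mem_lattice r k)
  convert h using 1
  ext1
  have e₁ : ∑ i : Fin n, m (Sum.inl i) • ((r i : ℝ) • (X (Sum.inl i) : HeisenbergAlgebra n)) =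
      (Sum.elim (fun i => (r i : ℝ) * m (Sum.inl i)) fun _ => 0, 0) := by
    refine Prod.ext (funext fun j => ?_) ?_
    · rcases j with j | j <;>
        simp [X, Prod.fst_sum, Finset.sum_apply, Pi.single_apply, mul_comm]
    · simp [X, Prod.snd_sum]
  have e₂ : ∑ i : Fin n, m (Sum.inr i) • (X (Sum.inr i) : HeisenbergAlgebra n) =
      (Sum.elim (fun _ => 0) fun i => (m (Sum.inr i) : ℝ), 0) := by
    refine Prod.ext (funext fun j => ?_) ?_
    · rcases j with j | j <;>
        simp [X, Prod.fst_sum, Finset.sum_apply, Pi.single_apply]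
    · simp [X, Prod.snd_sum]
  rw [e₁, e₂, log_mul, log_mul]
  refine Prod.ext (funext fun j => ?_) ?_
  · rcases j with j | j <;> simp [latticePoint, edge, Z]
  · simp [latticePoint, bracket, Z, add_comm]

lemma lattice_eq_latticePoints (r : Fin n → ℕ) : lattice r = latticePoints r := by
  refine le_antisymm ((Subgroup.closure_le _).2 ?_) ?_
  · rintro _ ((⟨i, rfl⟩ | ⟨i, rfl⟩) | rfl)
    · refine ⟨Pi.single (Sum.inl i) 1, 0, HeisenbergGroup.ext (Prod.ext (funext fun j => ?_) ?_)⟩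
      · rcases j with j | j <;> simp [latticePoint, X, edge, Pi.single_apply]
        split_ifs with h <;> simp [h]
      · simp [latticePoint, X]
    · refine ⟨Pi.single (Sum.inr i) 1, 0, HeisenbergGroup.ext (Prod.ext (funext fun j => ?_) ?_)⟩
      · rcases j with j | j <;> simp [latticePoint, X, edge, Pi.single_apply]
      · simp [latticePoint, X]
    · exact ⟨0, 1, HeisenbergGroup.ext (Prod.ext (funext fun j => by simp [latticePoint, Z])
        (by simp [latticePoint, Z]))⟩
  · rintro _ ⟨m, k, rfl⟩
    exact latticePoint_mem_lattice r m k

lemma mem_lattice {r : Fin n → ℕ} {x : HeisenbergGroup n} :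
    x ∈ lattice r ↔ ∃ m k, x = latticePoint r m k := by
  rw [lattice_eq_latticePoints]; rfl

lemma countable_lattice (r : Fin n → ℕ) : Countable (lattice r) := by
  have : (lattice r : Set (HeisenbergGroup n)) = range fun p : (Fin n ⊕ Fin n → ℤ) × ℤ =>
      latticePoint r p.1 p.2 := by
    ext x
    simp [mem_lattice, eq_comm]
  exact (this ▸ countable_range _ : (lattice r : Set (HeisenbergGroup n)).Countable).to_subtype

/-- An element with all coordinates of absolute value less than `1` is trivial: the horizontal
coordinates are integers, so they vanish, and then the central coordinate is the integer `k`. -/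
lemma isDiscrete_lattice {r : Fin n → ℕ} (hr : r ∈ latticeTypes n) :
    IsDiscrete (lattice r : Set (HeisenbergGroup n)) := by
  refine ⟨?_⟩
  suffices IsOpen ({1} : Set (lattice r)) from
    @discreteTopology_of_isOpen_singleton_one (lattice r) _ _ _ this
  have hcont : Continuous fun x : lattice r => (x : HeisenbergGroup n).log :=
    continuous_log.comp continuous_subtype_val
  have : ({1} : Set (lattice r)) = {x : lattice r | (∀ i, |(x : HeisenbergGroup n).log.1 i| < 1) ∧
      |(x : HeisenbergGroup n).log.2| < 1} := by
    ext ⟨x, hx⟩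
    simp only [mem_singleton_iff, mem_ofPred_eq, Subgroup.mk_eq_one]
    refine ⟨fun h => by simp [h, log_one], fun ⟨h₁, h₂⟩ => ?_⟩
    obtain ⟨m, k, rfl⟩ := mem_lattice.1 hx
    have hm : m = 0 := by
      funext i
      have := h₁ i
      simp only [latticePoint] at this
      have h' : |(edge r i : ℤ) * m i| < 1 := by exact_mod_cast this
      have := Int.abs_lt_one_iff.1 h'
      simpa [(edge_pos hr i).ne'] using this
    subst hm
    have hk : k = 0 := by
      have h' : |k| < 1 := by
        simp only [latticePoint, Pi.zero_apply, Int.cast_zero, mul_zero, Finset.sum_const_zero,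
          add_zero] at h₂
        exact_mod_cast h₂
      exact Int.abs_lt_one_iff.1 h'
    rw [hk, latticePoint_zero]
  rw [this, ofPred_and, ofPred_forall]
  refine (isOpen_iInter_of_finite fun i => ?_).inter ?_
  · exact isOpen_lt (by fun_prop) continuous_const
  · exact isOpen_lt (by fun_prop) continuous_const

/-! ### The covering of the Heisenberg manifold by the Heisenberg group -/

lemma isCoveringMap_mk {Γ : Subgroup (HeisenbergGroup n)}
    (hΓ : IsDiscrete (Γ : Set (HeisenbergGroup n))) :
    IsCoveringMap (Quotient.mk _ : HeisenbergGroup n → Manifold Γ) := by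
  refine (Topology.IsQuotientMap.isQuotientCoveringMap_of_subgroup (E := HeisenbergGroup n)
    (X := Manifold Γ) isQuotientMap_quotient_mk' Γ hΓ fun {e₁ e₂} => ?_).isCoveringMap
  exact Quotient.eq''.trans QuotientGroup.rightRel_apply

lemma mk_smul_eq (Γ : Subgroup (HeisenbergGroup n)) {γ x : HeisenbergGroup n} (hγ : γ ∈ Γ) :
    (Quotient.mk _ (γ * x) : Manifold Γ) = Quotient.mk _ x :=
  Quotient.sound ⟨⟨γ, hγ⟩, rfl⟩

end HeisenbergGroup

/-! ### Non-contractible loops and metric length in general spaces -/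

/-- Homotopic paths have lifts with the same end point once the starting point is fixed, and the
constant loop lifts to a constant path; uniqueness of lifts does the rest. -/
lemma IsCoveringMap.not_homotopic_refl {E X : Type*} [TopologicalSpace E] [TopologicalSpace X]
    {p : E → X} (hp : IsCoveringMap p) {x : X} (c : Path x x) (l : C(I, E))
    (hl : ∀ t, p (l t) = c t) (hne : l 0 ≠ l 1) : ¬ c.Homotopic (Path.refl x) := by
  intro h
  have h₀ : (c : C(I, X)) 0 = p (l 0) := (hl 0).symm
  have h₁ : (Path.refl x : C(I, X)) 0 = p (l 0) := by rw [hl 0]; simp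
  have key := hp.liftPath_apply_one_eq_of_homotopicRel h (l 0) h₀ h₁
  have e₀ : l = hp.liftPath c (l 0) h₀ := (hp.eq_liftPath_iff' _).2 ⟨funext hl, rfl⟩
  have e₁ : ContinuousMap.const I (l 0) = hp.liftPath (Path.refl x : C(I, X)) (l 0) h₁ :=
    (hp.eq_liftPath_iff' _).2 ⟨funext fun t => by simp [hl 0], rfl⟩
  exact hne ((congrArg (· 1) e₀).trans (key.trans (congrArg (· 1) e₁).symm)).symm

/-- The bounds telescope over any partition. Only this upper bound on the length is needed, so the
metric length is never computed. -/
lemma metricLength_le_of_dist_le {X : Type*} [TopologicalSpace X] {d : X → X → ℝ≥0∞} {x y : X}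
    {c : Path x y} {l : ℝ} (hl : 0 ≤ l)
    (h : ∀ s t : I, s ≤ t → d (c s) (c t) ≤ ENNReal.ofReal ((t - s) * l)) :
    metricLength d c ≤ ENNReal.ofReal l := by
  refine iSup_le fun ⟨N, u, hu⟩ => ?_
  calc ∑ i ∈ Finset.range N, d (c (u i)) (c (u (i + 1)))
      ≤ ∑ i ∈ Finset.range N, ENNReal.ofReal ((u (i + 1) - u i) * l) :=
        Finset.sum_le_sum fun i _ => h _ _ (hu i.le_succ)
    _ = ENNReal.ofReal (((u N : ℝ) - u 0) * l) := by
        rw [← ENNReal.ofReal_sum_of_nonneg, ← Finset.sum_mul,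
          Finset.sum_range_sub (fun i => (u i : ℝ))]
        intro i _
        exact mul_nonneg (sub_nonneg.2 (hu i.le_succ)) hl
    _ ≤ ENNReal.ofReal l := by
        refine ENNReal.ofReal_le_ofReal ?_
        have := (u N).2.2
        have := (u 0).2.1
        nlinarith

/-! ### Horizontal curves of constant speed -/

namespace HeisenbergGroup

open HeisenbergAlgebra

variable {n : ℕ}

lemma metric_smul (A : GL (Fin n ⊕ Fin n) ℝ) (a : ℝ) (u : HeisenbergAlgebra n) :
    metric A (a • u) (a • u) = a ^ 2 * metric A u u := by
  simp only [metric, Prod.smul_fst, Matrix.mulVec_smul, smul_dotProduct, dotProduct_smul,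
    smul_eq_mul]
  ring

lemma metric_self_nonneg (A : GL (Fin n ⊕ Fin n) ℝ) (u : HeisenbergAlgebra n) :
    0 ≤ metric A u u := by
  unfold metric dotProduct
  exact Finset.sum_nonneg fun _ _ => mul_self_nonneg _

lemma leftDiff_smul (x : HeisenbergGroup n) (a : ℝ) (u : HeisenbergAlgebra n) :
    leftDiff x (a • u) = a • leftDiff x u := by
  simp only [leftDiff, bracket_smul_right, smul_add, smul_comm a]

/-- A horizontal curve `c` of class `C¹`, whose velocity has left translate `u` to the identity. -/
structure IsHorizontalCurve (c : ℝ → HeisenbergGroup n) (u : ℝ → HeisenbergAlgebra n) : Prop where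
  continuous : Continuous u
  horizontal : ∀ t, u t ∈ horizontal n
  hasDerivAt : ∀ t, HasDerivAt (fun s => (c s).log) (leftDiff (c t) (u t)) t

namespace IsHorizontalCurve

variable {c : ℝ → HeisenbergGroup n} {u : ℝ → HeisenbergAlgebra n}

lemma continuous_log (h : IsHorizontalCurve c u) : Continuous fun t => (c t).log :=
  continuous_iff_continuousAt.2 fun t => (h.hasDerivAt t).continuousAt

lemma contDiff (h : IsHorizontalCurve c u) : ContDiff ℝ 1 fun t => (c t).log := by
  refine contDiff_one_iff_deriv.2 ⟨fun t => (h.hasDerivAt t).differentiableAt, ?_⟩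
  rw [funext fun t => (h.hasDerivAt t).deriv]
  have h₁ := h.continuous
  have h₂ := h.continuous_log.heisenbergBracket h₁
  unfold leftDiff
  fun_prop

lemma comp_affine (h : IsHorizontalCurve c u) (a b : ℝ) :
    IsHorizontalCurve (fun t => c (a + t * b)) (fun t => b • u (a + t * b)) where
  continuous := (h.continuous.comp (by fun_prop)).const_smul b
  horizontal t := Submodule.smul_mem _ _ (h.horizontal _)
  hasDerivAt t := by
    have h₁ : HasDerivAt (fun s : ℝ => a + s * b) b t := by
      simpa using ((hasDerivAt_id t).mul_const b).const_add a
    rw [leftDiff_smul]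
    exact (h.hasDerivAt (a + t * b)).scomp t h₁

lemma isAdmissible (h : IsHorizontalCurve c u) : IsAdmissible c :=
  ⟨h.contDiff.contDiffOn.absolutelyContinuousOnInterval,
    Filter.Eventually.of_forall fun t => ⟨u t, h.horizontal t, h.hasDerivAt t⟩⟩

lemma pathLength_eq (h : IsHorizontalCurve c u) (A : GL (Fin n ⊕ Fin n) ℝ) {l : ℝ} (hl : 0 ≤ l)
    (hu : ∀ t, metric A (u t) (u t) = l ^ 2) : pathLength A c = ENNReal.ofReal l := by
  unfold pathLength
  simp [fun t => (h.hasDerivAt t).deriv, leftDiffInv_leftDiff, hu, Real.sqrt_sq hl]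

/-- The arc from `s` to `t`, reparametrized affinely to `[0, 1]`, competes in the infimum; its speed
is multiplied by `t - s`. -/
lemma subRiemannianDist_le (h : IsHorizontalCurve c u) (A : GL (Fin n ⊕ Fin n) ℝ) {l : ℝ}
    (hl : 0 ≤ l) (hu : ∀ t, metric A (u t) (u t) = l ^ 2) {s t : ℝ} (hst : s ≤ t) :
    subRiemannianDist A (c s) (c t) ≤ ENNReal.ofReal ((t - s) * l) := by
  have h' := h.comp_affine s (t - s)
  rw [← h'.pathLength_eq A (mul_nonneg (sub_nonneg.2 hst) hl) fun τ => by
    rw [metric_smul, hu, mul_pow]]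
  exact iInf_le_of_le _ (iInf_le_of_le h'.isAdmissible
    (iInf_le_of_le (by simp) (iInf_le_of_le (by simp) le_rfl)))

/-- A horizontal curve of constant speed `l` on `[0, 1]`, whose end point is the translate of its
initial point by a nontrivial element of `Γ`, projects to a loop of `Γ \ H_n` which is not
contractible and whose length is at most `l`. -/
theorem systole_le (h : IsHorizontalCurve c u) (A : GL (Fin n ⊕ Fin n) ℝ) {l : ℝ} (hl : 0 ≤ l)
    (hu : ∀ t, metric A (u t) (u t) = l ^ 2) {Γ : Subgroup (HeisenbergGroup n)}
    (hΓ : IsDiscrete (Γ : Set (HeisenbergGroup n))) {γ : HeisenbergGroup n} (hγ : γ ∈ Γ)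
    (hγ₁ : γ ≠ 1) (hc : c 1 = γ * c 0) :
    systole (quotientDist Γ A) ≤ ENNReal.ofReal l := by
  let lift : C(I, HeisenbergGroup n) :=
    ⟨fun t => c t, (continuous_iff_log.2 h.continuous_log).comp continuous_subtype_val⟩
  let loop : Path (Quotient.mk _ (c 0) : Manifold Γ) (Quotient.mk _ (c 0)) :=
    { toFun := fun t => Quotient.mk _ (lift t)
      continuous_toFun := continuous_quotient_mk'.comp lift.continuous
      source' := by simp [lift]
      target' := by simp [lift, hc, mk_smul_eq Γ hγ] }
  have hloop : ¬ loop.Homotopic (Path.refl _) := by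
    refine (isCoveringMap_mk hΓ).not_homotopic_refl loop lift (fun t => rfl) ?_
    simp only [lift, ContinuousMap.coe_mk, Icc.coe_zero, Icc.coe_one, hc]
    simpa using hγ₁
  refine iInf_le_of_le _ (iInf_le_of_le loop (iInf_le_of_le hloop ?_))
  refine metricLength_le_of_dist_le hl fun s t hst => ?_
  have hle : quotientDist Γ A (loop s) (loop t) ≤ subRiemannianDist A (c s) (c t) :=
    iInf_le_of_le (c s) (iInf_le_of_le (c t) (iInf_le_of_le rfl (iInf_le_of_le rfl le_rfl)))
  exact hle.trans (h.subRiemannianDist_le A hl hu hst)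

end IsHorizontalCurve

/-! ### Straight loops -/

lemma bracket_comm_snd (u v : HeisenbergAlgebra n) : (bracket u v).2 = -(bracket v u).2 := by
  simp only [bracket, ← Finset.sum_neg_distrib]
  exact Finset.sum_congr rfl fun i _ => by ring

/-- The translate of a one-parameter subgroup is a horizontal curve. -/
lemma isHorizontalCurve_line (y v : Fin n ⊕ Fin n → ℝ) :
    IsHorizontalCurve (fun t => exp (y, 0) * exp (t • (v, 0))) (fun _ => (v, 0)) where
  continuous := continuous_const
  horizontal _ := rfl
  hasDerivAt t := by
    -- The curve is affine in logarithmic coordinates, since the Baker-Campbell-Hausdorff series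
    -- stops at the first bracket.
    have h : (fun s : ℝ => ((exp (y, 0) : HeisenbergGroup n) * exp (s • (v, 0))).log) =
        fun s => (y, 0) + s • (v, (1 / 2 : ℝ) * (bracket (y, 0) (v, 0) : HeisenbergAlgebra n).2) := by
      funext s
      rw [log_mul, bracket_smul_right]
      refine Prod.ext ?_ ?_ <;> simp
      ring
    rw [h]
    refine (((hasDerivAt_id t).smul_const
      (v, (1 / 2 : ℝ) * (bracket (y, 0) (v, 0) : HeisenbergAlgebra n).2)).const_add
        (y, (0 : ℝ))).congr_deriv ?_
    refine Prod.ext ?_ ?_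
    · simp [leftDiff]
    · simp only [leftDiff, log_mul, bracket, Prod.snd_add, Prod.smul_snd, Prod.fst_add,
        Prod.smul_fst, Pi.add_apply, Pi.smul_apply, smul_eq_mul, one_mul, zero_add]
      simp only [Finset.mul_sum, mul_zero, add_zero, Pi.zero_apply]
      exact Finset.sum_congr rfl fun i _ => by ring

/-- The systole is at most the length of the horizontal component of any element of the lattice for
which this component is nonzero. -/
theorem systole_le_of_mem (A : GL (Fin n ⊕ Fin n) ℝ) {Γ : Subgroup (HeisenbergGroup n)}
    (hΓ : IsDiscrete (Γ : Set (HeisenbergGroup n))) {γ : HeisenbergGroup n} (hγ : γ ∈ Γ)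
    (hγ₁ : γ.log.1 ≠ 0) :
    systole (quotientDist Γ A) ≤ ENNReal.ofReal √(metric A γ.log γ.log) := by
  -- With `v` the horizontal component of `γ`, the line from `exp y` in direction `v` must end at `γ
  -- * exp y`. Since `exp y * exp v * exp (-y) = exp (v + [y, v])`, this says that `[y, v]` is the
  -- central component of `γ`.
  obtain ⟨y, hy⟩ : ∃ y : Fin n ⊕ Fin n → ℝ,
      (bracket (y, 0) γ.log : HeisenbergAlgebra n).2 = γ.log.2 := by
    set v := γ.log.1
    have hv : dotProduct v v ≠ 0 := by simpa [dotProduct_self_eq_zero] using hγ₁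
    -- The symplectic rotation `J v` satisfies `[J v, v] = (v ⬝ v) Z`, so a multiple of it works.
    refine ⟨fun i => γ.log.2 / dotProduct v v *
      Sum.elim (fun i => v (Sum.inr i)) (fun i => -v (Sum.inl i)) i, ?_⟩
    have : (bracket (fun i => γ.log.2 / dotProduct v v *
        Sum.elim (fun i => v (Sum.inr i)) (fun i => -v (Sum.inl i)) i, 0) γ.log :
          HeisenbergAlgebra n).2 = γ.log.2 / dotProduct v v * dotProduct v v := by
      simp only [bracket, dotProduct, Fintype.sum_sum_type, ← Finset.sum_add_distrib, Sum.elim_inl,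
        Sum.elim_inr]
      rw [Finset.mul_sum]
      exact Finset.sum_congr rfl fun i _ => by simp only [v]; ring
    rw [this, div_mul_cancel₀ _ hv]
  refine (isHorizontalCurve_line y γ.log.1).systole_le A (Real.sqrt_nonneg _) (fun t => ?_) hΓ hγ
    (fun h => hγ₁ (by simp [h, log_one])) ?_
  · exact (Real.sq_sqrt (metric_self_nonneg A _)).symm
  · ext1
    rw [log_mul, log_mul, log_mul]
    refine Prod.ext ?_ ?_
    · simp [add_comm]
    · have h₁ : (bracket (y, 0) (γ.log.1, 0) : HeisenbergAlgebra n).2 = γ.log.2 := hy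
      have h₂ : (bracket γ.log (y, 0) : HeisenbergAlgebra n).2 = -γ.log.2 := by
        rw [bracket_comm_snd, hy]
      simp [h₁, h₂]
      ring

/-! ### Loops over circles -/

lemma bracket_combination (a b c d : ℝ) (x y : HeisenbergAlgebra n) :
    (bracket (a • x + b • y) (c • x + d • y)).2 = (a * d - b * c) * (bracket x y).2 := by
  simp only [bracket, Prod.fst_add, Prod.smul_fst, Pi.add_apply, Pi.smul_apply, smul_eq_mul,
    Finset.mul_sum]
  exact Finset.sum_congr rfl fun i _ => by ring

/-- The horizontal lift of a circle in the plane spanned by horizontal vectors `x` and `y`. -/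
noncomputable def circleLift (x y : HeisenbergAlgebra n) (t : ℝ) : HeisenbergGroup n :=
  -- The coefficient of the bracket is the signed area `½ ∫ (a db - b da)` swept by the plane curve
  -- `a = sin θ`, `b = 1 - cos θ`, with `θ = 2πt`; a full turn gives `π`.
  exp (Real.sin (2 * Real.pi * t) • x + (1 - Real.cos (2 * Real.pi * t)) • y +
    (Real.pi * t - Real.sin (2 * Real.pi * t) / 2) • bracket x y)

lemma isHorizontalCurve_circleLift {x y : HeisenbergAlgebra n} (hx : x ∈ horizontal n)
    (hy : y ∈ horizontal n) :
    IsHorizontalCurve (circleLift x y) fun t => (2 * Real.pi) •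
      (Real.cos (2 * Real.pi * t) • x + Real.sin (2 * Real.pi * t) • y) where
  continuous := by fun_prop
  horizontal t := Submodule.smul_mem _ _ (Submodule.add_mem _ (Submodule.smul_mem _ _ hx)
    (Submodule.smul_mem _ _ hy))
  hasDerivAt t := by
    have h₀ : HasDerivAt (fun t : ℝ => 2 * Real.pi * t) (2 * Real.pi) t := by
      simpa using (hasDerivAt_id t).const_mul (2 * Real.pi)
    have h₀' : HasDerivAt (fun t : ℝ => Real.pi * t) Real.pi t := by
      simpa using (hasDerivAt_id t).const_mul Real.pi
    have h := ((h₀.sin.smul_const x).add ((h₀.cos.const_sub 1).smul_const y)).add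
      ((h₀'.sub (h₀.sin.div_const 2)).smul_const (bracket x y))
    refine h.congr_deriv ?_
    rw [leftDiff_smul, leftDiff]
    refine Prod.ext ?_ ?_
    · simp only [Prod.fst_add, Prod.smul_fst, bracket_fst, smul_zero, add_zero, smul_add, smul_smul]
      congr 2 <;> ring
    · have e : (bracket (circleLift x y t).log
          (Real.cos (2 * Real.pi * t) • x + Real.sin (2 * Real.pi * t) • y)).2 =
          (1 - Real.cos (2 * Real.pi * t)) * (bracket x y).2 := by
        rw [circleLift, bracket_add_left, Prod.snd_add, bracket_combination]
        have : bracket ((Real.pi * t - Real.sin (2 * Real.pi * t) / 2) • bracket x y)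
          (Real.cos (2 * Real.pi * t) • x + Real.sin (2 * Real.pi * t) • y) = 0 :=
          Prod.ext rfl (by simp [bracket])
        rw [this, Prod.snd_zero]
        linear_combination (bracket x y).2 * Real.sin_sq_add_cos_sq (2 * Real.pi * t)
      have hx' : x.2 = 0 := hx
      have hy' : y.2 = 0 := hy
      simp only [Prod.snd_add, Prod.smul_snd, smul_eq_mul, e, hx', hy']
      ring

lemma circleLift_zero (x y : HeisenbergAlgebra n) : circleLift x y 0 = 1 := by
  simp [circleLift]; rfl

lemma circleLift_one (x y : HeisenbergAlgebra n) :
    circleLift x y 1 = exp (Real.pi • bracket x y) := by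
  simp [circleLift]

lemma metric_combination (A : GL (Fin n ⊕ Fin n) ℝ) {i j : Fin n ⊕ Fin n} (hij : i ≠ j) (a b : ℝ) :
    metric A (a • frame A i + b • frame A j) (a • frame A i + b • frame A j) = a ^ 2 + b ^ 2 := by
  have hii := metric_frame A i i
  have hjj := metric_frame A j j
  have hij' := metric_frame A i j
  have hji := metric_frame A j i
  simp only [if_true, if_neg hij, if_neg hij.symm, metric] at hii hjj hij' hji
  simp only [metric, Prod.fst_add, Prod.smul_fst, Matrix.mulVec_add, Matrix.mulVec_smul,
    add_dotProduct, dotProduct_add, smul_dotProduct, dotProduct_smul, smul_eq_mul, hii, hjj, hij',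
    hji]
  ring

/-- The systole is at most the length of a circle of area `1 / [A X_i, A X_j]`. -/
theorem systole_le_of_bracket_pos (A : GL (Fin n ⊕ Fin n) ℝ) {Γ : Subgroup (HeisenbergGroup n)}
    (hΓ : IsDiscrete (Γ : Set (HeisenbergGroup n))) (hZ : exp Z ∈ Γ) {i j : Fin n ⊕ Fin n}
    (h : 0 < (bracket (frame A i) (frame A j)).2) :
    systole (quotientDist Γ A) ≤
      ENNReal.ofReal (2 * √(Real.pi / (bracket (frame A i) (frame A j)).2)) := by
  set ω := (bracket (frame A i) (frame A j)).2 with hω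
  have hij : i ≠ j := by
    rintro rfl
    simp [hω] at h
  have hπ := Real.pi_pos
  -- The radius is chosen so that `π R² ω = 1`: one turn then climbs exactly to `exp Z`, with length
  -- `2πR = 2√(π / ω)`.
  set R := √(1 / (Real.pi * ω)) with hR
  have hR2 : R ^ 2 = 1 / (Real.pi * ω) := Real.sq_sqrt (by positivity)
  have hx : R • frame A i ∈ horizontal n := Submodule.smul_mem _ _ rfl
  have hy : R • frame A j ∈ horizontal n := Submodule.smul_mem _ _ rfl
  refine (isHorizontalCurve_circleLift hx hy).systole_le A (by positivity) (fun t => ?_) hΓ hZ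
    (fun hZ₁ => ?_) ?_
  · rw [metric_smul, smul_smul, smul_smul, metric_combination A hij, mul_pow 2 (√_),
      Real.sq_sqrt (by positivity)]
    have : (Real.cos (2 * Real.pi * t) * R) ^ 2 + (Real.sin (2 * Real.pi * t) * R) ^ 2 = R ^ 2 := by
      linear_combination R ^ 2 * Real.sin_sq_add_cos_sq (2 * Real.pi * t)
    rw [this, hR2]
    field_simp
  · have := congrArg (fun x : HeisenbergGroup n => x.log.2) hZ₁
    simp [Z, log_one] at this
  · rw [circleLift_zero, circleLift_one, mul_one]
    congr 1
    refine Prod.ext (by simp [Z]) ?_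
    have := bracket_combination R 0 0 R (frame A i) (frame A j)
    simp only [zero_smul, add_zero, zero_add] at this
    simp only [Prod.smul_snd, this, ← hω, Z, smul_eq_mul]
    rw [mul_zero, sub_zero, ← sq, hR2]
    field_simp

end HeisenbergGroup

namespace HeisenbergGroup

open HeisenbergAlgebra

variable {n : ℕ}

/-! ### The invariant measure -/

lemma measurable_log : Measurable (log : HeisenbergGroup n → HeisenbergAlgebra n) :=
  comap_measurable _

lemma measurable_iff_log {X : Type*} [MeasurableSpace X] {f : X → HeisenbergGroup n} :
    Measurable f ↔ Measurable fun x => (f x).log :=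
  measurable_comap_iff

/-- Left translation is a translation of the horizontal coordinates followed by a shear: the central
coordinate moves by an amount depending only on the horizontal ones. Fubini's theorem applies. -/
lemma measurePreserving_log_mul_exp (g : HeisenbergGroup n) :
    MeasurePreserving (fun v : HeisenbergAlgebra n => (g * exp v).log) := by
  rw [Measure.volume_eq_prod]
  have h := MeasurePreserving.skew_product (μa := (volume : Measure (Fin n ⊕ Fin n → ℝ)))
    (μc := (volume : Measure ℝ)) (μd := volume)
    (measurePreserving_add_left volume g.log.1)
    (g := fun v t => (1 / 2 : ℝ) * ∑ i : Fin n, (g.log.1 (Sum.inl i) * v (Sum.inr i) -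
      g.log.1 (Sum.inr i) * v (Sum.inl i)) + g.log.2 + t) (by unfold Function.uncurry; fun_prop)
    (Filter.Eventually.of_forall fun v => (measurePreserving_add_left volume _).map_eq)
  convert h using 2 with v
  refine Prod.ext ?_ ?_
  · simp [log_mul]
  · simp only [log_mul, bracket, Prod.snd_add, Prod.smul_snd, smul_eq_mul]
    ring

lemma measurePreserving_mul_left (g : HeisenbergGroup n) :
    MeasurePreserving (g * ·) (Measure.map exp volume) (Measure.map exp volume) := by
  have hT := measurePreserving_log_mul_exp g
  have hg : Measurable (g * · : HeisenbergGroup n → HeisenbergGroup n) :=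
    measurable_iff_log.2 (hT.measurable.comp measurable_log)
  refine ⟨hg, ?_⟩
  rw [Measure.map_map hg measurable_exp]
  have : (g * ·) ∘ exp = exp ∘ fun v : HeisenbergAlgebra n => (g * exp v).log := rfl
  rw [this, ← Measure.map_map measurable_exp hT.measurable, hT.map_eq]

instance (Γ : Subgroup (HeisenbergGroup n)) : MeasurableConstSMul Γ (HeisenbergGroup n) :=
  ⟨fun g => (measurePreserving_mul_left g.1).measurable⟩

instance (Γ : Subgroup (HeisenbergGroup n)) (A : GL (Fin n ⊕ Fin n) ℝ) :
    SMulInvariantMeasure Γ (HeisenbergGroup n) (poppMeasure A) := by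
  refine ⟨fun g s hs => ?_⟩
  have := (measurePreserving_mul_left g.1).measure_preimage hs.nullMeasurableSet
  simp only [poppMeasure, Measure.smul_apply]
  exact congrArg _ this

/-! ### A fundamental domain -/

/-- The box spanned by the generators of `Γ_r`, in exponential coordinates. -/
def box (r : Fin n → ℕ) : Set (HeisenbergAlgebra n) :=
  (univ.pi fun i => Ico 0 (edge r i : ℝ)) ×ˢ Ico 0 1

lemma measurableSet_box (r : Fin n → ℕ) : MeasurableSet (box r) :=
  (MeasurableSet.univ_pi fun _ => measurableSet_Ico).prod measurableSet_Ico

lemma volume_box (r : Fin n → ℕ) : volume (box r) = ENNReal.ofReal (∏ i, (r i : ℝ)) := by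
  rw [box, Measure.volume_eq_prod, Measure.prod_prod, Real.volume_pi_Ico, Real.volume_Ico,
    ← ENNReal.ofReal_prod_of_nonneg fun i _ => by simp]
  have : ∏ i, (edge r i : ℝ) = ∏ i, (r i : ℝ) := by exact_mod_cast prod_edge r
  simp [this]

/-- The horizontal coordinates of the translate depend on `m` only, so they determine `m`;
afterwards `k` shifts the central coordinate by an integer and is determined in turn. -/
lemma existsUnique_lattice_mul_mem_box {r : Fin n → ℕ} (hr : r ∈ latticeTypes n)
    (x : HeisenbergGroup n) : ∃! g : lattice r, (g * x : HeisenbergGroup n).log ∈ box r := by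
  have hm : ∀ i, ∃! m : ℤ, x.log.1 i + m • (edge r i : ℝ) ∈ Ico (0 : ℝ) (0 + edge r i) :=
    fun i => existsUnique_add_zsmul_mem_Ico (by exact_mod_cast edge_pos hr i) _ _
  choose m hm hm' using hm
  obtain ⟨k, hk, hk'⟩ := existsUnique_add_zsmul_mem_Ico one_pos (latticePoint r m 0 * x).log.2 0
  have key : ∀ (m' : Fin n ⊕ Fin n → ℤ) (k' : ℤ), (latticePoint r m' k' * x).log ∈ box r ↔
      (∀ i, x.log.1 i + m' i • (edge r i : ℝ) ∈ Ico (0 : ℝ) (0 + edge r i)) ∧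
        (latticePoint r m' 0 * x).log.2 + k' • (1 : ℝ) ∈ Ico (0 : ℝ) (0 + 1) := by
    intro m' k'
    have e₁ : ∀ i, (latticePoint r m' k' * x).log.1 i = x.log.1 i + m' i • (edge r i : ℝ) := by
      intro i
      simp [log_mul, latticePoint, add_comm, mul_comm]
    have e₂ : (latticePoint r m' k' * x).log.2 = (latticePoint r m' 0 * x).log.2 + k' • (1 : ℝ) := by
      simp only [log_mul, latticePoint, bracket, Prod.snd_add, Int.cast_zero, zsmul_eq_mul, mul_one]
      ring
    simp only [box, mem_prod, mem_pi, mem_univ, true_imp_iff, e₁, e₂, zero_add]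
  refine ⟨⟨_, latticePoint_mem_lattice r m k⟩, (key m k).2 ⟨hm, hk⟩, ?_⟩
  rintro ⟨g, hg⟩ h
  obtain ⟨m', k', rfl⟩ := mem_lattice.1 hg
  obtain ⟨h₁, h₂⟩ := (key m' k').1 h
  obtain rfl : m' = m := funext fun i => hm' i _ (h₁ i)
  obtain rfl := hk' _ h₂
  rfl

lemma isFundamentalDomain_box {r : Fin n → ℕ} (hr : r ∈ latticeTypes n)
    (μ : Measure (HeisenbergGroup n)) : IsFundamentalDomain (lattice r) (log ⁻¹' box r) μ :=
  .mk' (measurable_log (measurableSet_box r)).nullMeasurableSet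
    (existsUnique_lattice_mul_mem_box hr)

lemma poppNorm_nonneg (A : GL (Fin n ⊕ Fin n) ℝ) (z : HeisenbergAlgebra n) : 0 ≤ poppNorm A z :=
  Real.sInf_nonneg (by rintro _ ⟨t, -, rfl⟩; exact Real.sqrt_nonneg _)

lemma abs_det_adaptedCoframe (A : GL (Fin n ⊕ Fin n) ℝ) :
    |LinearMap.det (adaptedCoframe A)| =
      |(A⁻¹ : GL (Fin n ⊕ Fin n) ℝ).val.det| * poppNorm A Z := by
  have h : LinearMap.det (Matrix.mulVecLin (A⁻¹ : GL (Fin n ⊕ Fin n) ℝ).val) =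
      (A⁻¹ : GL (Fin n ⊕ Fin n) ℝ).val.det := by
    rw [← Matrix.toLin'_apply', LinearMap.det_toLin']
  rw [adaptedCoframe, LinearMap.det_prodMap, h, LinearMap.det_smul, abs_mul]
  simp [abs_of_nonneg (poppNorm_nonneg A Z)]

theorem totalPoppVolume_lattice {r : Fin n → ℕ} (hr : r ∈ latticeTypes n)
    (A : GL (Fin n ⊕ Fin n) ℝ) :
    totalPoppVolume (lattice r) A = ENNReal.ofReal
      (|(A⁻¹ : GL (Fin n ⊕ Fin n) ℝ).val.det| * (∏ i, (r i : ℝ)) * poppNorm A Z) := by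
  have := countable_lattice r
  rw [totalPoppVolume, (isFundamentalDomain_box hr (poppMeasure A)).covolume_eq_volume, poppMeasure,
    Measure.smul_apply, Measure.map_apply measurable_exp (measurable_log (measurableSet_box r)),
    abs_det_adaptedCoframe]
  have : (exp ⁻¹' (log ⁻¹' box r) : Set (HeisenbergAlgebra n)) = box r := rfl
  rw [this, volume_box, smul_eq_mul, ← ENNReal.ofReal_mul
    (mul_nonneg (abs_nonneg _) (poppNorm_nonneg A Z))]
  congr 1
  ring

end HeisenbergGroup

namespace HeisenbergGroup

open HeisenbergAlgebra

variable {n : ℕ}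

/-! ### Popp's norm -/

lemma bracket_sum_smul_left {ι : Type*} (s : Finset ι) (a : ι → ℝ) (u : ι → HeisenbergAlgebra n)
    (v : HeisenbergAlgebra n) :
    (bracket (∑ i ∈ s, a i • u i) v).2 = ∑ i ∈ s, a i * (bracket (u i) v).2 := by
  induction s using Finset.cons_induction with
  | empty => simp
  | cons i s hi ih =>
    rw [Finset.sum_cons, Finset.sum_cons, bracket_add_left, Prod.snd_add, ih]
    congr 1
    simp only [bracket, Prod.smul_fst, Pi.smul_apply, smul_eq_mul, Finset.mul_sum]
    exact Finset.sum_congr rfl fun i _ => by ring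

lemma sum_smul_frame (A : GL (Fin n ⊕ Fin n) ℝ) (i : Fin n ⊕ Fin n) :
    ∑ j, (A⁻¹ : GL (Fin n ⊕ Fin n) ℝ).val j i • frame A j = X i := by
  have h : A.val * (A⁻¹ : GL (Fin n ⊕ Fin n) ℝ).val = 1 := by
    rw [← Units.val_mul, mul_inv_cancel, Units.val_one]
  refine Prod.ext (funext fun k => ?_) ?_
  · have := congrFun (congrFun h k) i
    rw [Matrix.mul_apply] at this
    simp only [Prod.fst_sum, Prod.smul_fst, Finset.sum_apply, Pi.smul_apply, frame, X,
      Matrix.mulVec_single_one, Matrix.col_apply, smul_eq_mul]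
    rw [Matrix.one_apply] at this
    rw [Pi.single_apply, ← this]
    exact Finset.sum_congr rfl fun j _ => mul_comm _ _
  · simp [Prod.snd_sum, frame, X]

/-- The frame spans `𝔳₀`, so if all its brackets vanished then so would `[X_1, X_{n+1}] = Z`. -/
lemma exists_bracket_frame_ne_zero (hn : 1 ≤ n) (A : GL (Fin n ⊕ Fin n) ℝ) :
    ∃ i j, (bracket (frame A i) (frame A j)).2 ≠ 0 := by
  by_contra! h
  have h₁ : ∀ k j, (bracket (X k) (frame A j)).2 = 0 := fun k j => by
    rw [← sum_smul_frame A k, bracket_sum_smul_left]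
    simp [h]
  have h₂ : ∀ k l, (bracket (X k : HeisenbergAlgebra n) (X l)).2 = 0 := fun k l => by
    rw [bracket_comm_snd, ← sum_smul_frame A l, bracket_sum_smul_left]
    simp only [fun j => bracket_comm_snd (frame A j) (X k), h₁]
    simp
  have := h₂ (Sum.inl ⟨0, hn⟩) (Sum.inr ⟨0, hn⟩)
  simp [bracket, X, Pi.single_apply] at this

/-- Some bracket of vectors of the orthonormal frame is large compared to `1 / ‖Z‖`. -/
lemma exists_bracket_frame_pos (hn : 1 ≤ n) (A : GL (Fin n ⊕ Fin n) ℝ) :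
    ∃ i j, 0 < (bracket (frame A i) (frame A j)).2 ∧
      1 / (bracket (frame A i) (frame A j)).2 ≤ 2 * n * poppNorm A Z := by
  obtain ⟨i₀, j₀, h₀⟩ := exists_bracket_frame_ne_zero hn A
  have : Nonempty ((Fin n ⊕ Fin n) × (Fin n ⊕ Fin n)) := ⟨(i₀, j₀)⟩
  -- By antisymmetry, the largest bracket is also the largest in absolute value.
  obtain ⟨⟨i, j⟩, hmax⟩ := Finite.exists_max fun p : (Fin n ⊕ Fin n) × (Fin n ⊕ Fin n) =>
    (bracket (frame A p.1) (frame A p.2)).2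
  simp only at hmax
  have habs : ∀ k l, |(bracket (frame A k) (frame A l)).2| ≤ (bracket (frame A i) (frame A j)).2 :=
    fun k l => abs_le'.2 ⟨hmax (k, l), by rw [← bracket_comm_snd]; exact hmax (l, k)⟩
  set ω := (bracket (frame A i) (frame A j)).2
  have hω : 0 < ω := (abs_pos.2 h₀).trans_le (habs i₀ j₀)
  refine ⟨i, j, hω, ?_⟩
  have hn' : (0 : ℝ) < 2 * n := by positivity
  rw [← div_le_iff₀' hn', poppNorm]
  -- The lower bound on the infimum requires some tensor over `Z`: here `(1 / ω) A X_i ⊗ A X_j`.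
  refine le_csInf ⟨_, Matrix.single i j (1 / ω), ?_, rfl⟩ ?_
  · have h : ∑ k, ∑ l, Matrix.single i j (1 / ω) k l • bracket (frame A k) (frame A l) =
        (1 / ω) • bracket (frame A i) (frame A j) := by
      rw [Fintype.sum_eq_single i, Fintype.sum_eq_single j]
      · simp
      · intro l hl
        simp [hl.symm]
      · intro k hk
        simp [hk.symm]
    rw [h]
    change 1 / ω * ω - 1 = 0
    rw [one_div_mul_cancel hω.ne', sub_self]
  -- For every tensor `t` over `Z`, `1 ≤ ω ‖t‖₁ ≤ 2 n ω ‖t‖₂`; the second inequality is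
  -- Cauchy-Schwarz for the `(2n)²` entries.
  · rintro _ ⟨t, ht, rfl⟩
    have h₁ : ∑ k, ∑ l, t k l * (bracket (frame A k) (frame A l)).2 = 1 := by
      have : (∑ k, ∑ l, t k l • bracket (frame A k) (frame A l) - Z).2 = 0 := ht
      simpa [Prod.snd_sum, Z, sub_eq_zero] using this
    have h₂ : (1 : ℝ) ≤ ω * ∑ p : (Fin n ⊕ Fin n) × (Fin n ⊕ Fin n), |t p.1 p.2| := by
      rw [← h₁, Finset.mul_sum, ← Fintype.sum_prod_type']
      refine Finset.sum_le_sum fun p _ => (le_abs_self _).trans ?_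
      rw [abs_mul, mul_comm]
      exact mul_le_mul_of_nonneg_right (habs _ _) (abs_nonneg _)
    have h₃ : (∑ p : (Fin n ⊕ Fin n) × (Fin n ⊕ Fin n), |t p.1 p.2|) ^ 2 ≤
        (2 * n) ^ 2 * ∑ k, ∑ l, t k l ^ 2 := by
      refine (sq_sum_le_card_mul_sum_sq).trans_eq ?_
      rw [← Fintype.sum_prod_type' (f := fun k l => t k l ^ 2)]
      simp
      left; ring
    refine Real.le_sqrt_of_sq_le ?_
    have h₄ : (1 : ℝ) ≤ ω ^ 2 * ((2 * n) ^ 2 * ∑ k, ∑ l, t k l ^ 2) :=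
      (one_le_pow₀ h₂ (n := 2)).trans (by rw [mul_pow]; gcongr)
    rw [div_div, div_pow, one_pow, div_le_iff₀ (by positivity)]
    linarith

/-! ### Short vectors -/

lemma metric_self_le (A : GL (Fin n ⊕ Fin n) ℝ) (u : HeisenbergAlgebra n) {ρ : ℝ}
    (h : ∀ i, |(A⁻¹ : GL (Fin n ⊕ Fin n) ℝ).val.mulVec u.1 i| ≤ ρ) :
    metric A u u ≤ 2 * n * ρ ^ 2 := by
  have : metric A u u ≤ ∑ _i : Fin n ⊕ Fin n, ρ ^ 2 := by
    unfold metric dotProduct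
    exact Finset.sum_le_sum fun i _ => by
      rw [← sq, ← sq_abs]
      exact pow_le_pow_left₀ (abs_nonneg _) (h i) 2
  refine this.trans_eq ?_
  simp
  left; ring

/-- Minkowski's theorem for the cubes of `⟨·, ·⟩_A` and the lattice `(r_1 ℤ × ⋯ × r_n ℤ) × ℤ^n`. -/
lemma exists_short_vector {r : Fin n → ℕ} (hr : r ∈ latticeTypes n) (A : GL (Fin n ⊕ Fin n) ℝ)
    {ρ : ℝ} (hρ : 0 < ρ)
    (h : |(A⁻¹ : GL (Fin n ⊕ Fin n) ℝ).val.det| * ∏ i, (r i : ℝ) < ρ ^ (2 * n)) :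
    ∃ m : Fin n ⊕ Fin n → ℤ, m ≠ 0 ∧ ∀ i,
      |(A⁻¹ : GL (Fin n ⊕ Fin n) ℝ).val.mulVec (fun i => edge r i * m i) i| ≤ ρ := by
  set D : ℝ := |(A⁻¹ : GL (Fin n ⊕ Fin n) ℝ).val.det| * ∏ i, (r i : ℝ) with hD
  -- `B` carries `ℤ^{2n}` to the projected lattice written in the orthonormal frame, and `|det B| =
  -- D`.
  let B : Matrix (Fin n ⊕ Fin n) (Fin n ⊕ Fin n) ℝ :=
    (A⁻¹ : GL (Fin n ⊕ Fin n) ℝ).val * Matrix.diagonal fun i => (edge r i : ℝ)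
  have hprod : ∏ i, (edge r i : ℝ) = ∏ i, (r i : ℝ) := by exact_mod_cast prod_edge r
  have hr₀ : (0 : ℝ) < ∏ i, (r i : ℝ) := Finset.prod_pos fun i _ => by exact_mod_cast hr.1 i
  have hdet : LinearMap.det (Matrix.toLin' B) =
      (A⁻¹ : GL (Fin n ⊕ Fin n) ℝ).val.det * ∏ i, (r i : ℝ) := by
    rw [LinearMap.det_toLin', Matrix.det_mul, Matrix.det_diagonal, hprod]
  have hA : (A⁻¹ : GL (Fin n ⊕ Fin n) ℝ).val.det ≠ 0 :=
    ((Matrix.isUnit_iff_isUnit_det _).1 (A⁻¹).isUnit).ne_zero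
  have hdet₀ : LinearMap.det (Matrix.toLin' B) ≠ 0 := hdet ▸ mul_ne_zero hA hr₀.ne'
  have hD₀ : 0 < D := mul_pos (abs_pos.2 hA) hr₀
  have habs : |LinearMap.det (Matrix.toLin' B)| = D := by
    rw [hdet, abs_mul, abs_of_pos hr₀]
  let b := Pi.basisFun ℝ (Fin n ⊕ Fin n)
  -- The preimage of the open cube has volume `(2ρ)^{2n} / D`, which exceeds Minkowski's threshold
  -- `2^{2n}` exactly when `D < ρ^{2n}`.
  let s : Set (Fin n ⊕ Fin n → ℝ) := Matrix.toLin' B ⁻¹' univ.pi fun _ => Ioo (-ρ) ρ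
  have hconv : Convex ℝ s := (convex_pi fun _ _ => convex_Ioo _ _).linear_preimage _
  have hsymm : ∀ x ∈ s, -x ∈ s := fun x hx i hi => by
    have := hx i hi
    rw [map_neg]
    exact ⟨neg_lt_neg this.2, neg_lt.1 this.1⟩
  have hvol : volume (ZSpan.fundamentalDomain b) * 2 ^ Module.finrank ℝ (Fin n ⊕ Fin n → ℝ) <
      volume s := by
    have h1 : volume (ZSpan.fundamentalDomain b) = 1 := by
      simp [b, ZSpan.fundamentalDomain_pi_basisFun, Real.volume_pi_Ico]
    rw [h1, Measure.addHaar_preimage_linearMap _ hdet₀, abs_inv, habs, Real.volume_pi_Ioo]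
    have h2 : (2 : ℝ≥0∞) = ENNReal.ofReal 2 := by simp
    simp only [one_mul, sub_neg_eq_add,
      Finset.prod_const, Finset.card_univ, Fintype.card_sum, Fintype.card_fin,
      Module.finrank_fintype_fun_eq_card]
    rw [h2, ← ENNReal.ofReal_pow (by norm_num), ← ENNReal.ofReal_pow (by positivity),
      ← ENNReal.ofReal_mul (by positivity), ENNReal.ofReal_lt_ofReal_iff (by positivity),
      ← two_mul, ← two_mul, mul_pow, inv_mul_eq_div, lt_div_iff₀ hD₀]
    exact mul_lt_mul_of_pos_left h (by positivity)
  have : Countable (Submodule.span ℤ (range b)).toAddSubgroup :=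
    inferInstanceAs (Countable (Submodule.span ℤ (range b)))
  obtain ⟨⟨x, hx⟩, hx₀, hxs⟩ := exists_ne_zero_mem_lattice_of_measure_mul_two_pow_lt_measure
    (ZSpan.isAddFundamentalDomain' b volume) hsymm hconv hvol
  have hint : ∀ i, ∃ m : ℤ, (m : ℝ) = x i := by
    intro i
    have := (b.mem_span_iff_repr_mem ℤ x).1 hx i
    simpa [b] using this
  choose m hm using hint
  refine ⟨m, ?_, fun i => ?_⟩
  · rintro rfl
    exact hx₀ (Subtype.ext (funext fun i => by simp [← hm]))
  · have : (A⁻¹ : GL (Fin n ⊕ Fin n) ℝ).val.mulVec (fun i => edge r i * m i) = Matrix.toLin' B x := by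
      rw [Matrix.toLin'_apply, ← Matrix.mulVec_mulVec]
      congr 1
      funext i
      rw [Matrix.mulVec_diagonal, hm]
    rw [this]
    have := hxs i (mem_univ i)
    exact abs_le.2 ⟨this.1.le, this.2.le⟩

/-- Any lattice element over the Minkowski vector serves, as only its horizontal component enters
the bound; `k = 0` is taken. The factor `2 * n` compares the sup norm with the Euclidean norm. -/
lemma systole_le_of_lt_pow {r : Fin n → ℕ} (hr : r ∈ latticeTypes n) (A : GL (Fin n ⊕ Fin n) ℝ)
    {ρ : ℝ} (hρ : 0 < ρ)
    (h : |(A⁻¹ : GL (Fin n ⊕ Fin n) ℝ).val.det| * ∏ i, (r i : ℝ) < ρ ^ (2 * n)) :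
    systole (quotientDist (lattice r) A) ≤ ENNReal.ofReal √(2 * n * ρ ^ 2) := by
  obtain ⟨m, hm, hmρ⟩ := exists_short_vector hr A hρ h
  refine (systole_le_of_mem A (isDiscrete_lattice hr) (latticePoint_mem_lattice r m 0) ?_).trans
    (ENNReal.ofReal_le_ofReal (Real.sqrt_le_sqrt (metric_self_le A _ hmρ)))
  intro h₀
  refine hm (funext fun i => ?_)
  have := congrFun h₀ i
  simpa [latticePoint, (edge_pos hr i).ne'] using this

end HeisenbergGroup

/-! ### The systolic inequality -/

open HeisenbergGroup in
/-- For every `n ≥ 1` there is a positive constant `C`, depending only on `n`, such that on every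
compact Heisenberg manifold `Γ_r \ H_n` with a left invariant sub-Riemannian metric of corank one,
given by an invertible matrix `A`, the total Popp volume is finite and the systole is at most `C`
times its `1 / (2n + 2)`-th power. -/
theorem theoremA1 (n : ℕ) (hn : 1 ≤ n) :
    ∃ C : ℝ, 0 < C ∧
      ∀ r ∈ HeisenbergGroup.latticeTypes n, ∀ A : GL (Fin n ⊕ Fin n) ℝ,
        HeisenbergGroup.totalPoppVolume (HeisenbergGroup.lattice r) A ≠ ⊤ ∧
        systole (HeisenbergGroup.quotientDist (HeisenbergGroup.lattice r) A) ≤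
          ENNReal.ofReal C *
            HeisenbergGroup.totalPoppVolume (HeisenbergGroup.lattice r) A ^
              (1 / (2 * (n : ℝ) + 2)) := by
  have hπ := Real.pi_pos
  have hn₀ : (0 : ℝ) < n := by exact_mod_cast hn
  -- The product of the constants in `l₂ ^ (2n) = (8n)^n D` and `l₁ ^ 2 ≤ 8πn p` below.
  set K : ℝ := (8 * n) ^ n * (8 * Real.pi * n) with hK
  have hK₀ : 0 < K := by positivity
  refine ⟨K ^ (1 / (2 * (n : ℝ) + 2)), by positivity, fun r hr A => ?_⟩
  rw [totalPoppVolume_lattice hr A]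
  refine ⟨ENNReal.ofReal_ne_top, ?_⟩
  set D : ℝ := |(A⁻¹ : GL (Fin n ⊕ Fin n) ℝ).val.det| * ∏ i, (r i : ℝ) with hD
  have hD₀ : 0 < D := by
    refine mul_pos (abs_pos.2 ?_) (Finset.prod_pos fun i _ => by exact_mod_cast hr.1 i)
    exact ((Matrix.isUnit_iff_isUnit_det _).1 (A⁻¹).isUnit).ne_zero
  obtain ⟨i, j, hω, hp⟩ := exists_bracket_frame_pos hn A
  have hZ : exp HeisenbergAlgebra.Z ∈ lattice r := Subgroup.subset_closure (by simp)
  have s₁ := systole_le_of_bracket_pos A (isDiscrete_lattice hr) hZ hω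
  set ω := (HeisenbergAlgebra.bracket (frame A i) (frame A j)).2
  set p := poppNorm A HeisenbergAlgebra.Z
  have hp₀ : 0 < p := by
    have : 0 < 2 * n * p := (by positivity : 0 < 1 / ω).trans_le hp
    exact pos_of_mul_pos_right this (by positivity)
  -- The factor `2` makes Minkowski's inequality `D < ρ ^ (2n) = 4^n D` strict.
  set ρ : ℝ := 2 * D ^ (1 / (2 * (n : ℝ)))
  have hρ₀ : 0 < ρ := by positivity
  have hρ : ρ ^ (2 * n) = 4 ^ n * D := by
    rw [mul_pow, ← Real.rpow_natCast (D ^ _), ← Real.rpow_mul hD₀.le, pow_mul]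
    push_cast
    rw [one_div_mul_cancel (by positivity), Real.rpow_one]
    norm_num
  have s₂ := systole_le_of_lt_pow hr A hρ₀ (by
    rw [hρ]
    have : (1 : ℝ) < 4 ^ n := one_lt_pow₀ (by norm_num) (by omega)
    nlinarith)
  set l₁ := 2 * √(Real.pi / ω)
  set l₂ := √(2 * n * ρ ^ 2)
  have hl₁ : l₁ ^ 2 ≤ 8 * Real.pi * n * p := by
    rw [mul_pow, Real.sq_sqrt (by positivity)]
    calc 2 ^ 2 * (Real.pi / ω) = 4 * Real.pi * (1 / ω) := by ring
      _ ≤ 4 * Real.pi * (2 * n * p) := by gcongr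
      _ = _ := by ring
  have hl₂ : l₂ ^ (2 * n) = (8 * n) ^ n * D := by
    rw [pow_mul, Real.sq_sqrt (by positivity), mul_pow, ← pow_mul, hρ, ← mul_assoc, ← mul_pow]
    ring
  -- The minimum obeys both bounds, so `l ^ (2n) * l ^ 2` is controlled by the product `D * p`,
  -- which is the volume.
  set l := min l₁ l₂
  have hl₀ : 0 ≤ l := le_min (by positivity) (by positivity)
  have hl : l ^ (2 * n + 2) ≤ K * (D * p) := by
    calc l ^ (2 * n + 2) = l ^ (2 * n) * l ^ 2 := pow_add _ _ _
      _ ≤ l₂ ^ (2 * n) * l₁ ^ 2 := by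
        gcongr
        · exact min_le_right _ _
        · exact min_le_left _ _
      _ ≤ (8 * n) ^ n * D * (8 * Real.pi * n * p) := by rw [hl₂]; gcongr
      _ = _ := by ring
  have hsys : systole (quotientDist (lattice r) A) ≤ ENNReal.ofReal l := by
    rw [ENNReal.ofReal_min]
    exact le_min s₁ s₂
  rw [ENNReal.ofReal_rpow_of_nonneg (by positivity) (by positivity),
    ← ENNReal.ofReal_mul (by positivity), ← Real.mul_rpow (by positivity) (by positivity)]
  refine hsys.trans (ENNReal.ofReal_le_ofReal ?_)
  have := Real.rpow_le_rpow (by positivity) hl (by positivity : 0 ≤ 1 / (2 * (n : ℝ) + 2))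
  have hexp : ((2 * n + 2 : ℕ) : ℝ) * (1 / (2 * n + 2)) = 1 := by
    push_cast
    field_simp
  rwa [← Real.rpow_natCast, ← Real.rpow_mul hl₀, hexp, Real.rpow_one] at this
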